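/- For $n\in\mathbb N$ let $[n]=\{1,\dots,n\}$. For a permutation $\sigma$ of $[n]$ let $P_\sigma$ be its $n\times n$ permutation matrix, with $P_\sigma(i,j)=1$ if $\sigma(i)=j$ and $0$ otherwise, and let $P^{[2]}_\sigma\in\mathbb R^{n^2\times n^2}$ be the matrix with entries $P^{[2]}_\sigma(ij,kl)=P_\sigma(i,j)\,P_\sigma(k,l)$. The QAP polytope is $\mathrm{QAP}_n=\operatorname{conv}\{P^{[2]}_\sigma : \sigma\in S_n\}\subset\mathbb R^{n^2\times n^2}$. The Jünger–Kaibel (QAP2) inequalities are, for all $P,Q\subset[n]$ and $\beta\in\mathbb N$ with $\beta+1\le |P|,|Q|\le n-3$, $|P|+|Q|\le n-3+\beta$ and $\beta\ge 2$, the inequalities in the variable $Y\in\mathbb R^{n^2\times n^2}$ $$(\beta-1)\sum_{(i,j)\in P\times Q}Y_{ij,ij}\;-\sum_{\substack{(i,j),(k,l)\in P\times Q\\ i<k}}Y_{ij,kl}\;\le\;\frac{\beta^2-\beta}{2}.$$ A polytope is the bounded solution set of a finite system of linear inequalities. A polytope $K\subset\mathbb R^{d+r}$ (with $r\ge 0$)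 is an extended formulation of a polytope $R\subset\mathbb R^d$ if $R=\{x\in\mathbb R^d : \exists\, y\in\mathbb R^r,\ (x,y)\in K\}$. The extension complexity $\mathrm{xc}(R)$ is the minimum number of facets of an extended formulation of $R$. Theorem. There are a constant $c>0$ and an integer $n_0$ such that for every $n\ge n_0$ and every polytope $R\subset\mathbb R^{n^2\times n^2}$ with $\mathrm{QAP}_n\subseteq R$ for which all the QAP2 inequalities are valid (that is, satisfied by every point of $R$), $$\mathrm{xc}(R)\ \ge\ 2^{c n}.$$ In other words, every bounded relaxation of $\mathrm{QAP}_n$ for which the QAP2 inequalities are valid has extension complexity $2^{\Omega(n)}$, uniformly over all such relaxations. -/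

import Mathlib

namespace QAPExt

/-! ### Polytopes, facets, extended formulations -/

/-- A polytope in `ℝ^ι`: the bounded solution set of a finite system `A x ≤ b` of linear
inequalities. -/
def IsPolytope {ι : Type} [Fintype ι] (P : Set (ι → ℝ)) : Prop :=
  (∃ (m : ℕ) (A : Matrix (Fin m) ι ℝ) (b : Fin m → ℝ),
      P = {x | ∀ i : Fin m, (A.mulVec x) i ≤ b i}) ∧
    Bornology.IsBounded P

/-- The dimension of a nonempty set in `ℝ^ι`, that is, the dimension of its affine hull. -/
noncomputable def affDim {ι : Type} (P : Set (ι → ℝ)) : ℕ :=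
  Module.finrank ℝ (vectorSpan ℝ P)

/-- `F` is a face of `P`: the set of points of `P` at which some inequality `a · x ≤ b`, valid on
`P`, holds with equality. -/
def IsFace {ι : Type} [Fintype ι] (P F : Set (ι → ℝ)) : Prop :=
  ∃ (a : ι → ℝ) (b : ℝ), (∀ x ∈ P, dotProduct a x ≤ b) ∧ F = {x | x ∈ P ∧ dotProduct a x = b}

/-- `F` is a facet of `P`: a (nonempty) face whose dimension is one less than that of `P`. -/
def IsFacet {ι : Type} [Fintype ι] (P F : Set (ι → ℝ)) : Prop :=
  IsFace P F ∧ F.Nonempty ∧ affDim F + 1 = affDim P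

/-- The size of a polytope: its number of facets. -/
noncomputable def size {ι : Type} [Fintype ι] (P : Set (ι → ℝ)) : ℕ∞ :=
  {F | IsFacet P F}.encard

/-- The polytope `Q ⊆ ℝ^(ι + r)` is an extended formulation of `P ⊆ ℝ^ι`:
`P = {x | ∃ y ∈ ℝ^r, (x, y) ∈ Q}`. -/
def IsExtension {ι : Type} [Fintype ι] (P : Set (ι → ℝ)) (r : ℕ) (Q : Set (ι ⊕ Fin r → ℝ)) :
    Prop :=
  IsPolytope Q ∧ P = {x | ∃ y : Fin r → ℝ, Sum.elim x y ∈ Q}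

/-- The extension complexity: the least size of an extended formulation. -/
noncomputable def extensionComplexity {ι : Type} [Fintype ι] (P : Set (ι → ℝ)) : ℕ∞ :=
  sInf {s | ∃ (r : ℕ) (Q : Set (ι ⊕ Fin r → ℝ)), IsExtension P r Q ∧ s = size Q}

/-! ### The QAP polytope and the Jünger–Kaibel inequalities -/

/-- Index set of the entries `Y ((i, j), (k, l))` of a real `n² × n²` matrix `Y`. -/
abbrev QAPIndex (n : ℕ) : Type := (Fin n × Fin n) × (Fin n × Fin n)

/-- Entry `(i, j)` of the permutation matrix of `σ`: it is `1` if `σ i = j` and `0` otherwise. -/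
def permEntry {n : ℕ} (σ : Equiv.Perm (Fin n)) (i j : Fin n) : ℝ := if σ i = j then 1 else 0

/-- The matrix `y yᵀ`, where `y` is the vectorization of the permutation matrix of `σ`. -/
def qapVertex {n : ℕ} (σ : Equiv.Perm (Fin n)) : QAPIndex n → ℝ :=
  fun p => permEntry σ p.1.1 p.1.2 * permEntry σ p.2.1 p.2.2

/-- The QAP polytope: the convex hull of the matrices `y yᵀ`. -/
def qapPolytope (n : ℕ) : Set (QAPIndex n → ℝ) :=
  convexHull ℝ (Set.range (qapVertex (n := n)))

/-- The admissible parameters: `β + 1 ≤ |P|, |Q| ≤ n - 3`, `|P| + |Q| ≤ n - 3 + β`, `β ≥ 2`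
(written without subtraction of natural numbers). -/
def QAP2Admissible {n : ℕ} (P Q : Finset (Fin n)) (β : ℕ) : Prop :=
  (β + 1 ≤ P.card ∧ P.card + 3 ≤ n) ∧ (β + 1 ≤ Q.card ∧ Q.card + 3 ≤ n) ∧
    P.card + Q.card + 3 ≤ n + β ∧ 2 ≤ β

/-- The inequality
`(β - 1) ∑_{(i,j) ∈ P × Q} Y_{ij,ij} - ∑_{(i,j), (k,l) ∈ P × Q, i < k} Y_{ij,kl} ≤ (β² - β) / 2`. -/
def QAP2Inequality {n : ℕ} (P Q : Finset (Fin n)) (β : ℕ) (Y : QAPIndex n → ℝ) : Prop :=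
  ((β : ℝ) - 1) * (∑ p ∈ P ×ˢ Q, Y (p, p))
      - (∑ p ∈ P ×ˢ Q, ∑ q ∈ P ×ˢ Q, if p.1 < q.1 then Y (p, q) else 0)
    ≤ ((β : ℝ) ^ 2 - (β : ℝ)) / 2

/-- All the Jünger–Kaibel inequalities are valid for `R`. -/
def QAP2Valid {n : ℕ} (R : Set (QAPIndex n → ℝ)) : Prop :=
  ∀ (P Q : Finset (Fin n)) (β : ℕ), QAP2Admissible P Q β → ∀ Y ∈ R, QAP2Inequality P Q β Y

end QAPExt

/-!
Fix disjoint sets `S`, `T` of indices with `|T| = 3` and an involution `τ` of `[n]` mapping `S ∪ T`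
off itself. For `a ⊆ S` let `G a` be the face of `R` on which the QAP2 inequality for
`P = Q = a ∪ T`, `β = 2` is tight, and for `b ⊆ S` let `y b` be the QAP vertex of the permutation
that fixes `b` and agrees with `τ` on the rest of `S ∪ T`. At `y b` the slack of the inequality is
`(k - 1) (k - 2) / 2` with `k = |a ∩ b|`, so `y b ∉ G a` if `a` and `b` are disjoint and `y b ∈ G a`
if they meet in exactly one element.

This pattern lifts to every extended formulation `K`. There, whenever `y b ∉ G a`, some facet of `K`
contains `G a` but not `y b`; hence the rectangles `{a | G a ⊆ F} × {b | y b ∉ F}` of the facets `F`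
cover all `3 ^ |S|` disjoint pairs and contain no pair with `|a ∩ b| = 1`. Induction on `S` shows
that such a rectangle contains at most `2 ^ |S|` disjoint pairs, so `K` has at least `(3 / 2) ^ |S|`
facets.
-/

namespace QAPExt

section Polyhedra

variable {E κ : Type*} [AddCommGroup E] [Module ℝ E]
  {f : κ → Module.Dual ℝ E} {b : κ → ℝ} {K : Set E} {s : Finset κ}

/-- Polyhedra in an arbitrary real vector space: the solution sets of finite systems of linear
inequalities. -/
def IsPolyhedron (K : Set E) : Prop :=
  ∃ (m : ℕ) (f : Fin m → Module.Dual ℝ E) (b : Fin m → ℝ), K = {x | ∀ i, f i x ≤ b i}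

/-- The inequalities `f i x ≤ b i` with `i ∈ s` describe `K` inside its affine hull. Describing `K`
only relative to its affine hull is what makes each member of an irredundant description define a
facet, also when `K` is not full-dimensional. -/
def IsCutOutBy (f : κ → Module.Dual ℝ E) (b : κ → ℝ) (K : Set E) (s : Finset κ) : Prop :=
  ∀ x, x ∈ K ↔ x ∈ affineSpan ℝ K ∧ ∀ i ∈ s, f i x ≤ b i

theorem IsPolyhedron.exists_minimal_isCutOutBy (hK : IsPolyhedron K) :
    ∃ (m : ℕ) (f : Fin m → Module.Dual ℝ E) (b : Fin m → ℝ) (s : Finset (Fin m)),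
      Minimal (IsCutOutBy f b K) s := by
  obtain ⟨m, f, b, rfl⟩ := hK
  have hall : IsCutOutBy f b {x | ∀ i, f i x ≤ b i} Finset.univ := fun x =>
    ⟨fun hx => ⟨subset_affineSpan ℝ _ hx, fun i _ => hx i⟩, fun hx i => hx.2 i (Finset.mem_univ i)⟩
  exact ⟨m, f, b, exists_minimal_of_wellFoundedLT _ ⟨_, hall⟩⟩

theorem IsCutOutBy.convex (h : IsCutOutBy f b K s) : Convex ℝ K := by
  have hK : K = (affineSpan ℝ K : Set E) ∩ ⋂ i ∈ s, {x | f i x ≤ b i} := by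
    ext x
    simpa using h x
  rw [hK]
  exact (affineSpan ℝ K).convex.inter
    (convex_iInter₂ fun i _ => convex_halfSpace_le (f i).isLinear (b i))

theorem exists_forall_lt_of_convex {C : Set E} (hC : Convex ℝ C) (hne : C.Nonempty)
    (hle : ∀ i ∈ s, ∀ x ∈ C, f i x ≤ b i) (hlt : ∀ i ∈ s, ∃ x ∈ C, f i x < b i) :
    ∃ x ∈ C, ∀ i ∈ s, f i x < b i := by
  classical
  induction s using Finset.induction_on with
  | empty =>
    obtain ⟨x, hx⟩ := hne
    exact ⟨x, hx, by simp⟩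
  | insert i s _ ih =>
    simp only [Finset.forall_mem_insert] at hle hlt ⊢
    obtain ⟨y, hyC, hy⟩ := hlt.1
    obtain ⟨x, hxC, hx⟩ := ih hle.2 hlt.2
    have hmid (j : κ) : f j (midpoint ℝ x y) = (f j x + f j y) / 2 := by
      rw [midpoint_eq_smul_add, map_smul, map_add, smul_eq_mul, invOf_eq_inv]
      ring
    refine ⟨midpoint ℝ x y, hC.midpoint_mem hxC hyC, ?_, fun j hj => ?_⟩
    · linarith [hmid i, hle.1 x hxC]
    · linarith [hmid j, hx j hj, hle.2 j hj y hyC]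

theorem IsCutOutBy.exists_pos_add_smul_mem (h : IsCutOutBy f b K s) {x d : E} (hx : x ∈ K)
    (hd : d ∈ vectorSpan ℝ K) (hxd : ∀ i ∈ s, f i x < b i ∨ f i d ≤ 0) :
    ∃ ε : ℝ, 0 < ε ∧ x + ε • d ∈ K := by
  have hsmall : ∀ᶠ ε : ℝ in nhdsWithin 0 (Set.Ioi 0), ∀ i ∈ s, f i x + ε * f i d ≤ b i := by
    rw [Filter.eventually_all_finset]
    intro i hi
    rcases hxd i hi with hlt | hle
    · have hlim : Filter.Tendsto (fun ε : ℝ => f i x + ε * f i d) (nhds 0) (nhds (f i x)) :=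
        Continuous.tendsto' (by fun_prop) 0 _ (by simp)
      exact ((hlim.eventually_lt_const hlt).filter_mono nhdsWithin_le_nhds).mono fun _ => le_of_lt
    · filter_upwards [self_mem_nhdsWithin] with ε hε
      linarith [((h x).1 hx).2 i hi, mul_nonpos_of_nonneg_of_nonpos (le_of_lt hε) hle]
  obtain ⟨ε, hε, hpos⟩ := (hsmall.and self_mem_nhdsWithin).exists
  refine ⟨ε, hpos, (h _).2 ⟨?_, fun i hi => by simpa using hε i hi⟩⟩
  rw [add_comm]
  exact vadd_mem_affineSpan_of_mem_affineSpan_of_mem_vectorSpan (subset_affineSpan ℝ K hx)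
    (Submodule.smul_mem _ ε hd)

theorem exists_violating_only_of_minimal (h : Minimal (IsCutOutBy f b K) s) {i : κ} (hi : i ∈ s) :
    ∃ z ∈ affineSpan ℝ K, b i < f i z ∧ ∀ j ∈ s, j ≠ i → f j z ≤ b j := by
  classical
  by_contra! hredundant
  refine h.not_prop_of_lt (Finset.erase_ssubset hi) fun x => ⟨fun hx => ?_, fun hx => ?_⟩
  · exact ⟨subset_affineSpan ℝ K hx, fun j hj => ((h.1 x).1 hx).2 j (Finset.mem_of_mem_erase hj)⟩
  · have hother (j) (hj : j ∈ s) (hji : j ≠ i) := hx.2 j (Finset.mem_erase.2 ⟨hji, hj⟩)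
    have hxi : f i x ≤ b i := by
      by_contra! hlt
      obtain ⟨j, hj, hji, hbj⟩ := hredundant x hx.1 hlt
      exact hbj.not_ge (hother j hj hji)
    refine (h.1 x).2 ⟨hx.1, fun j hj => ?_⟩
    rcases eq_or_ne j i with rfl | hji
    exacts [hxi, hother j hj hji]

theorem exists_forall_lt_of_minimal (h : Minimal (IsCutOutBy f b K) s) (hne : K.Nonempty) :
    ∃ x ∈ K, ∀ i ∈ s, f i x < b i := by
  refine exists_forall_lt_of_convex h.1.convex hne (fun i hi x hx => ((h.1 x).1 hx).2 i hi) ?_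
  intro i hi
  by_contra! hge
  have hconst : Set.EqOn (f i).toAffineMap (AffineMap.const ℝ E (b i)) K := fun x hx =>
    (((h.1 x).1 hx).2 i hi).antisymm (hge x hx)
  obtain ⟨z, hz, hzi, -⟩ := exists_violating_only_of_minimal h hi
  exact hzi.ne' (AffineMap.eqOn_affineSpan hconst hz)

theorem exists_tight_only_of_minimal (h : Minimal (IsCutOutBy f b K) s) {i : κ} (hi : i ∈ s) :
    ∃ w ∈ K, f i w = b i ∧ ∀ j ∈ s, j ≠ i → f j w < b j := by
  obtain ⟨z, hz, hzi, hzj⟩ := exists_violating_only_of_minimal h hi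
  obtain ⟨x, hxK, hx⟩ := exists_forall_lt_of_minimal h ((affineSpan_nonempty ℝ).1 ⟨z, hz⟩)
  have hxi := hx i hi
  set t := (b i - f i x) / (f i z - f i x) with ht
  have ht0 : 0 < t := div_pos (by linarith) (by linarith)
  have ht1 : t < 1 := (div_lt_one (by linarith)).2 (by linarith)
  have hline (j : κ) : f j (AffineMap.lineMap x z t) = f j x + t * (f j z - f j x) := by
    simp [AffineMap.lineMap_apply, add_comm]
  have hwi : f i (AffineMap.lineMap x z t) = b i := by
    rw [hline, ht, div_mul_cancel₀ _ (by linarith)]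
    ring
  have hwj : ∀ j ∈ s, j ≠ i → f j (AffineMap.lineMap x z t) < b j := fun j hj hji => by
    rw [hline]
    nlinarith [hx j hj, hzj j hj hji]
  refine ⟨AffineMap.lineMap x z t, (h.1 _).2 ⟨?_, fun j hj => ?_⟩, hwi, hwj⟩
  · exact AffineMap.lineMap_mem t (subset_affineSpan ℝ K hxK) hz
  · rcases eq_or_ne j i with rfl | hji
    exacts [hwi.le, (hwj j hj hji).le]

theorem vectorSpan_tight_eq_of_minimal (h : Minimal (IsCutOutBy f b K) s) {i : κ} (hi : i ∈ s) :
    vectorSpan ℝ {x | x ∈ K ∧ f i x = b i} = vectorSpan ℝ K ⊓ LinearMap.ker (f i) := by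
  apply le_antisymm
  · rw [vectorSpan_def, Submodule.span_le]
    rintro _ ⟨x, ⟨hxK, hx⟩, y, ⟨hyK, hy⟩, rfl⟩
    exact ⟨vsub_mem_vectorSpan ℝ hxK hyK, by simp [hx, hy]⟩
  · rintro d ⟨hdK, hd⟩
    rw [SetLike.mem_coe, LinearMap.mem_ker] at hd
    obtain ⟨w, hwK, hwi, hwj⟩ := exists_tight_only_of_minimal h hi
    obtain ⟨ε, hε, hmem⟩ := h.1.exists_pos_add_smul_mem hwK hdK fun j hj => by
      rcases eq_or_ne j i with rfl | hji
      exacts [Or.inr hd.le, Or.inl (hwj j hj hji)]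
    have hspan : (w + ε • d) -ᵥ w ∈ vectorSpan ℝ {x | x ∈ K ∧ f i x = b i} :=
      vsub_mem_vectorSpan ℝ ⟨hmem, by simp [hd, hwi]⟩ ⟨hwK, hwi⟩
    rwa [vsub_eq_sub, add_sub_cancel_left, Submodule.smul_mem_iff _ hε.ne'] at hspan

theorem not_vectorSpan_le_ker_of_minimal (h : Minimal (IsCutOutBy f b K) s) {i : κ}
    (hi : i ∈ s) : ¬ vectorSpan ℝ K ≤ LinearMap.ker (f i) := fun hle => by
  obtain ⟨z, hz, hzi, -⟩ := exists_violating_only_of_minimal h hi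
  obtain ⟨w, hwK, hwi, -⟩ := exists_tight_only_of_minimal h hi
  have hzw := hle (vsub_mem_vectorSpan_of_mem_affineSpan_of_mem_affineSpan hz
    (subset_affineSpan ℝ K hwK))
  rw [vsub_eq_sub, LinearMap.mem_ker, map_sub] at hzw
  linarith

theorem IsCutOutBy.exists_tight_on_face_of_notMem (h : IsCutOutBy f b K s) {g : Module.Dual ℝ E}
    {c : ℝ} (hg : ∀ x ∈ K, g x ≤ c) (hne : {x | x ∈ K ∧ g x = c}.Nonempty) {y : E} (hyK : y ∈ K)
    (hy : g y ≠ c) : ∃ i ∈ s, (∀ x ∈ K, g x = c → f i x = b i) ∧ f i y ≠ b i := by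
  classical
  by_contra! htight
  -- Starting at a generic point `x` of the face, one can move a little away from `y` inside `K`.
  obtain ⟨x, ⟨hxK, hx⟩, hlt⟩ := exists_forall_lt_of_convex
    (s := s.filter fun i => ∃ x ∈ K, g x = c ∧ f i x ≠ b i) (f := f) (b := b)
    (h.convex.inter (convex_hyperplane g.isLinear c)) hne
    (fun i hi x hx => ((h x).1 hx.1).2 i (Finset.mem_filter.1 hi).1) fun i hi => by
      obtain ⟨his, x, hxK, hx, hxi⟩ := Finset.mem_filter.1 hi
      exact ⟨x, ⟨hxK, hx⟩, lt_of_le_of_ne (((h x).1 hxK).2 i his) hxi⟩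
  obtain ⟨ε, hε, hmem⟩ := h.exists_pos_add_smul_mem hxK (vsub_mem_vectorSpan ℝ hxK hyK)
    fun i hi => by
      by_cases hact : ∀ x ∈ K, g x = c → f i x = b i
      · exact Or.inr (by simp [hact x hxK hx, htight i hi hact])
      · push Not at hact
        exact Or.inl (hlt i (Finset.mem_filter.2 ⟨hi, hact⟩))
  have hle := hg _ hmem
  simp only [vsub_eq_sub, map_add, map_smul, map_sub, smul_eq_mul] at hle
  have hyc : g y < c := lt_of_le_of_ne (hg y hyK) hy
  have hxc : g x = c := hx
  nlinarith

end Polyhedra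

section Facets

theorem finrank_inf_ker_add_one {𝕜 V : Type*} [Field 𝕜] [AddCommGroup V] [Module 𝕜 V]
    {g : Module.Dual 𝕜 V} {W : Submodule 𝕜 V} [FiniteDimensional 𝕜 W]
    (hg : ¬ W ≤ LinearMap.ker g) :
    Module.finrank 𝕜 ↥(W ⊓ LinearMap.ker g) + 1 = Module.finrank 𝕜 W := by
  have hne : g.domRestrict W ≠ 0 := fun h0 => hg fun w hw => LinearMap.congr_fun h0 ⟨w, hw⟩
  rw [← Module.Dual.finrank_ker_add_one_of_ne_zero hne, LinearMap.ker_domRestrict,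
    ← Submodule.map_comap_subtype, Submodule.finrank_map_subtype_eq]

variable {ι : Type} [Fintype ι] {K : Set (ι → ℝ)}

theorem isFace_iff_exists_dual {F : Set (ι → ℝ)} :
    IsFace K F ↔ ∃ (g : Module.Dual ℝ (ι → ℝ)) (c : ℝ),
      (∀ x ∈ K, g x ≤ c) ∧ F = {x | x ∈ K ∧ g x = c} := by
  classical
  exact (dotProductEquiv ℝ ι).toEquiv.exists_congr fun a => by simp

theorem IsPolytope.isPolyhedron (hK : IsPolytope K) : IsPolyhedron K := by
  obtain ⟨⟨m, A, b, rfl⟩, -⟩ := hK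
  exact ⟨m, fun i => LinearMap.proj i ∘ₗ A.mulVecLin, b, rfl⟩

theorem isFacet_of_minimal {κ : Type*} {f : κ → Module.Dual ℝ (ι → ℝ)} {b : κ → ℝ} {s : Finset κ}
    (h : Minimal (IsCutOutBy f b K) s) {i : κ} (hi : i ∈ s) :
    IsFacet K {x | x ∈ K ∧ f i x = b i} := by
  obtain ⟨w, hwK, hw, -⟩ := exists_tight_only_of_minimal h hi
  refine ⟨isFace_iff_exists_dual.2 ⟨f i, b i, fun x hx => ((h.1 x).1 hx).2 i hi, rfl⟩,
    ⟨w, hwK, hw⟩, ?_⟩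
  rw [affDim, affDim, vectorSpan_tight_eq_of_minimal h hi]
  exact finrank_inf_ker_add_one (not_vectorSpan_le_ker_of_minimal h hi)

theorem IsPolyhedron.exists_isFacet_superset_notMem (hK : IsPolyhedron K) {G : Set (ι → ℝ)}
    (hG : IsFace K G) (hne : G.Nonempty) {y : ι → ℝ} (hyK : y ∈ K) (hyG : y ∉ G) :
    ∃ F, IsFacet K F ∧ G ⊆ F ∧ y ∉ F := by
  obtain ⟨m, f, b, s, hmin⟩ := hK.exists_minimal_isCutOutBy
  obtain ⟨g, c, hg, rfl⟩ := isFace_iff_exists_dual.1 hG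
  obtain ⟨i, hi, htight, hyi⟩ :=
    hmin.1.exists_tight_on_face_of_notMem hg hne hyK fun hy => hyG ⟨hyK, hy⟩
  exact ⟨_, isFacet_of_minimal hmin hi, fun x hx => ⟨hx.1, htight x hx.1 hx.2⟩, fun hy => hyi hy.2⟩

end Facets

section Rectangles

variable {α : Type*} [DecidableEq α] {S : Finset α}

/-- The support of the unique disjointness matrix: the pairs of disjoint subsets of `S`. -/
def disjointPairs (S : Finset α) : Finset (Finset α × Finset α) :=
  (S.powerset ×ˢ S.powerset).filter fun p => Disjoint p.1 p.2

theorem mem_disjointPairs {p : Finset α × Finset α} :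
    p ∈ disjointPairs S ↔ (p.1 ⊆ S ∧ p.2 ⊆ S) ∧ Disjoint p.1 p.2 := by
  simp [disjointPairs]

theorem sum_disjointPairs_insert {M : Type*} [AddCommMonoid M] {x : α} (hx : x ∉ S)
    (w : Finset α → Finset α → M) :
    ∑ p ∈ disjointPairs (insert x S), w p.1 p.2 =
      ∑ p ∈ disjointPairs S, (w p.1 p.2 + w p.1 (insert x p.2) + w (insert x p.1) p.2) := by
  simp only [disjointPairs, Finset.sum_filter, Finset.sum_product, Finset.sum_powerset_insert hx]
  rw [← Finset.sum_add_distrib]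
  refine Finset.sum_congr rfl fun a ha => ?_
  simp only [← Finset.sum_add_distrib]
  refine Finset.sum_congr rfl fun b hb => ?_
  have hxa : x ∉ a := fun h => hx (Finset.mem_powerset.1 ha h)
  have hxb : x ∉ b := fun h => hx (Finset.mem_powerset.1 hb h)
  by_cases hab : Disjoint a b <;> simp [hxa, hxb, hab]

theorem card_disjointPairs (S : Finset α) : (disjointPairs S).card = 3 ^ S.card := by
  induction S using Finset.induction_on with
  | empty => rfl
  | insert x S hx ih =>
    rw [Finset.card_eq_sum_ones, sum_disjointPairs_insert hx fun _ _ => 1,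
      Finset.card_insert_of_notMem hx, pow_succ, ← ih, Finset.sum_const, smul_eq_mul]

open Classical in
theorem card_filter_disjointPairs_le (p q : Finset α → Prop)
    (h : ∀ a ⊆ S, ∀ b ⊆ S, p a → q b → (a ∩ b).card ≠ 1) :
    ((disjointPairs S).filter fun P => p P.1 ∧ q P.2).card ≤ 2 ^ S.card := by
  induction S using Finset.induction_on generalizing p q with
  | empty => exact (Finset.card_filter_le _ _).trans (by simp [card_disjointPairs])
  | insert x S hx ih =>
    have hnot {a : Finset α} (ha : a ⊆ S) : x ∉ a := fun h => hx (ha h)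
    have hsub {a : Finset α} (ha : a ⊆ S) : a ⊆ insert x S := ha.trans (Finset.subset_insert x S)
    have hins {a : Finset α} (ha : a ⊆ S) : insert x a ⊆ insert x S :=
      Finset.insert_subset_insert x ha
    -- Of the three extensions of a disjoint pair by `x`, at most two lie in the rectangle, and
    -- these are charged to the two rectangles obtained by forgetting `x` on one side.
    have hleft := ih (fun a => p a ∨ p (insert x a)) q <| by
      rintro a ha b hb (hp | hp) hq
      · exact h a (hsub ha) b (hsub hb) hp hq
      · simpa [Finset.insert_inter_of_notMem (hnot hb)] using h _ (hins ha) b (hsub hb) hp hq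
    have hright := ih p (fun b => q b ∨ q (insert x b)) <| by
      rintro a ha b hb hp (hq | hq)
      · exact h a (hsub ha) b (hsub hb) hp hq
      · simpa [Finset.inter_insert_of_notMem (hnot ha)] using h a (hsub ha) _ (hins hb) hp hq
    rw [Finset.card_insert_of_notMem hx, pow_succ, mul_two]
    refine le_trans ?_ (add_le_add hleft hright)
    rw [Finset.card_filter, Finset.card_filter, Finset.card_filter,
      sum_disjointPairs_insert hx fun a b => if p a ∧ q b then 1 else 0, ← Finset.sum_add_distrib]
    refine Finset.sum_le_sum fun P hP => ?_
    obtain ⟨⟨ha, hb⟩, hdisj⟩ := mem_disjointPairs.1 hP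
    have hboth : ¬ (p (insert x P.1) ∧ q (insert x P.2)) := fun ⟨hp, hq⟩ =>
      h _ (hins ha) _ (hins hb) hp hq <| by
        rw [← Finset.insert_inter_distrib, Finset.disjoint_iff_inter_eq_empty.1 hdisj]
        rfl
    grind

theorem three_pow_le_of_rectangle_cover {κ : Type*} (I : Finset κ) (p q : κ → Finset α → Prop)
    (hcover : ∀ a ⊆ S, ∀ b ⊆ S, Disjoint a b → ∃ k ∈ I, p k a ∧ q k b)
    (h : ∀ k ∈ I, ∀ a ⊆ S, ∀ b ⊆ S, p k a → q k b → (a ∩ b).card ≠ 1) :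
    3 ^ S.card ≤ I.card * 2 ^ S.card := by
  classical
  calc 3 ^ S.card
      = (disjointPairs S).card := (card_disjointPairs S).symm
    _ ≤ (I.biUnion fun k => (disjointPairs S).filter fun P => p k P.1 ∧ q k P.2).card := by
        refine Finset.card_le_card fun P hP => ?_
        obtain ⟨⟨ha, hb⟩, hdisj⟩ := mem_disjointPairs.1 hP
        obtain ⟨k, hk, hpq⟩ := hcover _ ha _ hb hdisj
        exact Finset.mem_biUnion.2 ⟨k, hk, Finset.mem_filter.2 ⟨hP, hpq⟩⟩
    _ ≤ I.card * 2 ^ S.card :=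
        Finset.card_biUnion_le_card_mul _ _ _ fun k hk => card_filter_disjointPairs_le _ _ (h k hk)

end Rectangles

section ExtensionComplexity

variable {ι : Type} [Fintype ι] {α : Type*} [DecidableEq α] {S : Finset α}

/-- The faces `G a` and points `y b` of `K`, indexed by subsets of `S`, realize a unique
disjointness pattern: `y b` lies outside `G a` if `a` and `b` are disjoint and inside `G a` if they
meet in exactly one element, with no condition on the remaining pairs. -/
structure RealizesDisjointness (K : Set (ι → ℝ)) (S : Finset α) (G : Finset α → Set (ι → ℝ))
    (y : Finset α → ι → ℝ) : Prop where
  isFace : ∀ a ⊆ S, IsFace K (G a)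
  nonempty : ∀ a ⊆ S, (G a).Nonempty
  mem : ∀ b ⊆ S, y b ∈ K
  notMem_of_disjoint : ∀ a ⊆ S, ∀ b ⊆ S, Disjoint a b → y b ∉ G a
  mem_of_card_inter_eq_one : ∀ a ⊆ S, ∀ b ⊆ S, (a ∩ b).card = 1 → y b ∈ G a

theorem RealizesDisjointness.three_pow_le_size_mul_two_pow {K : Set (ι → ℝ)}
    {G : Finset α → Set (ι → ℝ)} {y : Finset α → ι → ℝ} (h : RealizesDisjointness K S G y)
    (hK : IsPolyhedron K) : (3 : ℕ∞) ^ S.card ≤ size K * 2 ^ S.card := by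
  rcases {F | IsFacet K F}.finite_or_infinite with hfin | hinf
  · rw [size, hfin.encard_eq_coe_toFinset_card]
    norm_cast
    refine three_pow_le_of_rectangle_cover hfin.toFinset (fun F a => G a ⊆ F) (fun F b => y b ∉ F)
      (fun a ha b hb hab => ?_) fun F _ a ha b hb hGF hyF hab =>
        hyF (hGF (h.mem_of_card_inter_eq_one a ha b hb hab))
    simpa using hK.exists_isFacet_superset_notMem (h.isFace a ha) (h.nonempty a ha) (h.mem b hb)
      (h.notMem_of_disjoint a ha b hb hab)
  · simp [size, hinf.encard_eq]

theorem IsFace.subset {K F : Set (ι → ℝ)} (hF : IsFace K F) : F ⊆ K := by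
  obtain ⟨a, c, -, rfl⟩ := hF
  exact fun x hx => hx.1

theorem IsExtension.isFace_preimage {R : Set (ι → ℝ)} {r : ℕ} {K : Set (ι ⊕ Fin r → ℝ)}
    (hK : IsExtension R r K) {F : Set (ι → ℝ)} (hF : IsFace R F) :
    IsFace K {x | x ∈ K ∧ x ∘ Sum.inl ∈ F} := by
  obtain ⟨g, c, hg, rfl⟩ := isFace_iff_exists_dual.1 hF
  have hproj : ∀ x ∈ K, x ∘ Sum.inl ∈ R := fun x hx => by
    rw [hK.2]
    exact ⟨x ∘ Sum.inr, by rwa [Sum.elim_comp_inl_inr]⟩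
  refine isFace_iff_exists_dual.2 ⟨g ∘ₗ LinearMap.funLeft ℝ ℝ Sum.inl, c,
    fun x hx => hg _ (hproj x hx), ?_⟩
  ext x
  exact and_congr_right fun hx => and_iff_right (hproj x hx)

theorem RealizesDisjointness.exists_lift {R : Set (ι → ℝ)} {G : Finset α → Set (ι → ℝ)}
    {y : Finset α → ι → ℝ} (h : RealizesDisjointness R S G y) {r : ℕ} {K : Set (ι ⊕ Fin r → ℝ)}
    (hK : IsExtension R r K) : ∃ G' y', RealizesDisjointness K S G' y' := by
  have hlift : ∀ x ∈ R, ∃ u, Sum.elim x u ∈ K := fun x hx => by rwa [hK.2] at hx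
  have hlift' (b : Finset α) : ∃ u, b ⊆ S → Sum.elim (y b) u ∈ K := by
    by_cases hb : b ⊆ S
    · exact (hlift _ (h.mem b hb)).imp fun u hu _ => hu
    · exact ⟨0, fun hb' => absurd hb' hb⟩
  choose u hu using hlift'
  refine ⟨fun a => {x | x ∈ K ∧ x ∘ Sum.inl ∈ G a}, fun b => Sum.elim (y b) (u b),
    fun a ha => hK.isFace_preimage (h.isFace a ha), fun a ha => ?_, hu, ?_, ?_⟩
  · obtain ⟨x, hx⟩ := h.nonempty a ha
    obtain ⟨v, hv⟩ := hlift x ((h.isFace a ha).subset hx)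
    exact ⟨Sum.elim x v, hv, hx⟩
  · exact fun a ha b hb hab hy => h.notMem_of_disjoint a ha b hb hab hy.2
  · exact fun a ha b hb hab => ⟨hu b hb, h.mem_of_card_inter_eq_one a ha b hb hab⟩

theorem RealizesDisjointness.three_pow_le_extensionComplexity_mul_two_pow {R : Set (ι → ℝ)}
    {G : Finset α → Set (ι → ℝ)} {y : Finset α → ι → ℝ} (h : RealizesDisjointness R S G y) :
    (3 : ℕ∞) ^ S.card ≤ extensionComplexity R * 2 ^ S.card := by
  rcases Set.eq_empty_or_nonempty
      {s | ∃ (r : ℕ) (K : Set (ι ⊕ Fin r → ℝ)), IsExtension R r K ∧ s = size K} with hempty | hne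
  · simp [extensionComplexity, hempty]
  · obtain ⟨r, K, hK, hsize⟩ := csInf_mem hne
    obtain ⟨G', y', h'⟩ := h.exists_lift hK
    rw [extensionComplexity, hsize]
    exact h'.three_pow_le_size_mul_two_pow hK.1.isPolyhedron

end ExtensionComplexity

section QAP

variable {n : ℕ}

/-- The left-hand side of the QAP2 inequality with parameters `P`, `Q`, `β`. -/
def qap2Functional (P Q : Finset (Fin n)) (β : ℕ) : Module.Dual ℝ (QAPIndex n → ℝ) :=
  ((β : ℝ) - 1) • ∑ p ∈ P ×ˢ Q, LinearMap.proj (p, p) -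
    ∑ p ∈ P ×ˢ Q, ∑ q ∈ P ×ˢ Q, if p.1 < q.1 then LinearMap.proj (p, q) else 0

theorem qap2Functional_apply (P Q : Finset (Fin n)) (β : ℕ) (Y : QAPIndex n → ℝ) :
    qap2Functional P Q β Y = ((β : ℝ) - 1) * (∑ p ∈ P ×ˢ Q, Y (p, p)) -
      ∑ p ∈ P ×ˢ Q, ∑ q ∈ P ×ˢ Q, if p.1 < q.1 then Y (p, q) else 0 := by
  simp only [qap2Functional, LinearMap.sub_apply, LinearMap.smul_apply, LinearMap.sum_apply,
    smul_eq_mul, apply_ite (fun f : Module.Dual ℝ (QAPIndex n → ℝ) => f Y), LinearMap.proj_apply,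
    LinearMap.zero_apply]

theorem qap2Inequality_iff (P Q : Finset (Fin n)) (β : ℕ) (Y : QAPIndex n → ℝ) :
    QAP2Inequality P Q β Y ↔ qap2Functional P Q β Y ≤ ((β : ℝ) ^ 2 - β) / 2 := by
  rw [qap2Functional_apply, QAP2Inequality]

theorem sum_permEntry_mul (σ : Equiv.Perm (Fin n)) (P Q : Finset (Fin n))
    (g : Fin n × Fin n → ℝ) :
    ∑ p ∈ P ×ˢ Q, permEntry σ p.1 p.2 * g p = ∑ i ∈ P with σ i ∈ Q, g (i, σ i) := by
  simp [permEntry, Finset.sum_product, Finset.sum_filter]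

theorem qap2Functional_qapVertex (P Q : Finset (Fin n)) (β : ℕ) (σ : Equiv.Perm (Fin n)) :
    qap2Functional P Q β (qapVertex σ) = ((β : ℝ) - 1) * (P.filter fun i => σ i ∈ Q).card -
      ((P.filter fun i => σ i ∈ Q).card.choose 2 : ℕ) := by
  set T := P.filter fun i => σ i ∈ Q
  have hdiag : ∑ p ∈ P ×ˢ Q, qapVertex σ (p, p) = T.card := by
    simp only [qapVertex, sum_permEntry_mul]
    simp [permEntry, T]
  have hpairs : ∑ p ∈ P ×ˢ Q, ∑ q ∈ P ×ˢ Q, (if p.1 < q.1 then qapVertex σ (p, q) else 0) =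
      (T.card.choose 2 : ℕ) := by
    have hfactor (p q : Fin n × Fin n) : (if p.1 < q.1 then qapVertex σ (p, q) else 0) =
        permEntry σ p.1 p.2 * (permEntry σ q.1 q.2 * if p.1 < q.1 then 1 else 0) := by
      simp [qapVertex]
    simp only [hfactor, ← Finset.mul_sum, sum_permEntry_mul]
    rw [← Finset.card_product_filter_lt, Finset.card_filter, Finset.sum_product]
    push_cast
    rfl
  rw [qap2Functional_apply, hdiag, hpairs]

theorem qap2Functional_two_qapVertex_of_card_le_one {P Q : Finset (Fin n)}
    {σ : Equiv.Perm (Fin n)} (h : (P.filter fun i => σ i ∈ Q).card ≤ 1) :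
    qap2Functional P Q 2 (qapVertex σ) = (P.filter fun i => σ i ∈ Q).card := by
  rw [qap2Functional_qapVertex, Nat.choose_eq_zero_of_lt (by lia)]
  norm_num

/-- The involution that fixes the points of `B` and of `τ B` and agrees with the involution `τ`
elsewhere. If `τ` maps `U` off itself, then inside `U` its graph records exactly the set `B`. -/
def fixing {α : Type*} [DecidableEq α] {τ : α → α} (hτ : Function.Involutive τ) (B : Finset α) :
    Equiv.Perm α :=
  Function.Involutive.toPerm (fun i => if i ∈ B ∨ τ i ∈ B then i else τ i) fun i => by
    by_cases h : i ∈ B ∨ τ i ∈ B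
    · simp only [h, if_true]
    · simp only [h, if_false, hτ i, or_comm (a := τ i ∈ B)]

theorem filter_fixing_mem {α : Type*} [DecidableEq α] {τ : α → α} (hτ : Function.Involutive τ)
    {U A B : Finset α} (hU : ∀ i ∈ U, τ i ∉ U) (hA : A ⊆ U) (hB : B ⊆ U) :
    (A.filter fun i => fixing hτ B i ∈ A) = A ∩ B := by
  ext i
  rw [Finset.mem_filter, Finset.mem_inter]
  refine and_congr_right fun hi => ?_
  have hτB : τ i ∉ B := fun h => hU i (hA hi) (hB h)
  have hτA : τ i ∉ A := fun h => hU i (hA hi) (hA h)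
  change (if i ∈ B ∨ τ i ∈ B then i else τ i) ∈ A ↔ i ∈ B
  by_cases hiB : i ∈ B <;> simp [hiB, hτB, hτA, hi]

theorem qap2Functional_two_qapVertex_fixing {τ : Fin n → Fin n} (hτ : Function.Involutive τ)
    {U A B : Finset (Fin n)} (hU : ∀ i ∈ U, τ i ∉ U) (hA : A ⊆ U) (hB : B ⊆ U)
    (hAB : (A ∩ B).card ≤ 1) :
    qap2Functional A A 2 (qapVertex (fixing hτ B)) = (A ∩ B).card := by
  rw [← filter_fixing_mem hτ hU hA hB] at hAB ⊢
  exact qap2Functional_two_qapVertex_of_card_le_one hAB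

theorem isFace_qap2Functional_two_eq_one {R : Set (QAPIndex n → ℝ)} {P Q : Finset (Fin n)}
    (hR : ∀ Y ∈ R, QAP2Inequality P Q 2 Y) :
    IsFace R {Y | Y ∈ R ∧ qap2Functional P Q 2 Y = 1} := by
  refine isFace_iff_exists_dual.2 ⟨_, 1, fun Y hY => ?_, rfl⟩
  have hle := (qap2Inequality_iff _ _ _ _).1 (hR Y hY)
  norm_num at hle
  exact hle

-- Since `τ` maps `S ∪ T` off itself, no vertex `y_b` sees the padding of `a ⊆ S` by `T`, which
-- only serves to make `P = Q = a ∪ T` large enough for `β = 2`.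
theorem realizesDisjointness_of_qap2 {R : Set (QAPIndex n → ℝ)} (hQAP : qapPolytope n ⊆ R)
    (hvalid : ∀ P, QAP2Admissible P P 2 → ∀ Y ∈ R, QAP2Inequality P P 2 Y)
    {τ : Fin n → Fin n} (hτ : Function.Involutive τ) {S T : Finset (Fin n)}
    (hST : Disjoint S T) (hτST : ∀ i ∈ S ∪ T, τ i ∉ S ∪ T) (hT : 3 ≤ T.card)
    (hcard : 2 * (S ∪ T).card + 1 ≤ n) :
    RealizesDisjointness R S
      (fun a => {Y | Y ∈ R ∧ qap2Functional (a ∪ T) (a ∪ T) 2 Y = 1})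
      (fun b => qapVertex (fixing hτ b)) := by
  have hpad {a} (ha : a ⊆ S) : a ∪ T ⊆ S ∪ T := Finset.union_subset_union_left ha
  have hvertex (σ) : qapVertex σ ∈ R := hQAP (subset_convexHull ℝ _ ⟨σ, rfl⟩)
  have hadm {a} (ha : a ⊆ S) : QAP2Admissible (a ∪ T) (a ∪ T) 2 := by
    have hle := Finset.card_le_card (hpad ha)
    have hge : T.card ≤ (a ∪ T).card := Finset.card_le_card Finset.subset_union_right
    unfold QAP2Admissible
    lia
  have hvalue {a b} (ha : a ⊆ S) (hb : b ⊆ S) (hab : (a ∩ b).card ≤ 1) :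
      qap2Functional (a ∪ T) (a ∪ T) 2 (qapVertex (fixing hτ b)) = (a ∩ b).card := by
    have hinter : (a ∪ T) ∩ b = a ∩ b := by
      rw [Finset.union_inter_distrib_right,
        Finset.disjoint_iff_inter_eq_empty.1 (hST.mono_left hb).symm, Finset.union_empty]
    rw [← hinter] at hab ⊢
    exact qap2Functional_two_qapVertex_fixing hτ hτST (hpad ha)
      (hb.trans Finset.subset_union_left) hab
  refine ⟨fun a ha => isFace_qap2Functional_two_eq_one (hvalid _ (hadm ha)), fun a ha => ?_,
    fun b _ => hvertex _, fun a ha b hb hab hY => ?_, fun a ha b hb hab => ⟨hvertex _, ?_⟩⟩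
  · obtain ⟨t, ht⟩ := Finset.card_pos.1 (by lia : 0 < T.card)
    have hone : ((a ∪ T) ∩ {t}).card = 1 := by simp [ht]
    refine ⟨_, hvertex (fixing hτ {t}), ?_⟩
    rw [qap2Functional_two_qapVertex_fixing hτ hτST (hpad ha) (by simp [ht]) hone.le, hone,
      Nat.cast_one]
  · have hzero : (a ∩ b).card = 0 := by simpa using Finset.disjoint_iff_inter_eq_empty.1 hab
    have hone := hY.2
    rw [hvalue ha hb (by lia), hzero, Nat.cast_zero] at hone
    exact zero_ne_one hone
  · rw [hvalue ha hb hab.le, hab, Nat.cast_one]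

theorem three_pow_le_extensionComplexity_of_qap2 (hn : 7 ≤ n) {R : Set (QAPIndex n → ℝ)}
    (hQAP : qapPolytope n ⊆ R)
    (hvalid : ∀ P, QAP2Admissible P P 2 → ∀ Y ∈ R, QAP2Inequality P P 2 Y) :
    (3 : ℕ∞) ^ ((n - 7) / 2) ≤ extensionComplexity R * 2 ^ ((n - 7) / 2) := by
  set U : Finset (Fin n) := Finset.univ.filter fun i => (i : ℕ) < (n - 1) / 2
  have hU : U.card = (n - 1) / 2 := by
    rw [Fin.card_filter_val_lt]
    lia
  have hrev : ∀ i ∈ U, i.rev ∉ U := by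
    intro i hi
    simp only [U, Finset.mem_filter_univ, Fin.val_rev] at hi ⊢
    lia
  obtain ⟨T, hTU, hT⟩ := Finset.exists_subset_card_eq (by lia : 3 ≤ U.card)
  have hunion : U \ T ∪ T = U := Finset.sdiff_union_of_subset hTU
  have hreal := realizesDisjointness_of_qap2 hQAP hvalid Fin.rev_involutive
    Finset.sdiff_disjoint (by rwa [hunion]) hT.ge (by rw [hunion]; lia)
  have hS : (U \ T).card = (n - 7) / 2 := by
    rw [Finset.card_sdiff_of_subset hTU]
    lia
  simpa only [hS] using hreal.three_pow_le_extensionComplexity_mul_two_pow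

end QAP

theorem ofReal_two_rpow_le_of_three_pow_le {m : ℕ} {N : ℕ∞} {x : ℝ}
    (h : (3 : ℕ∞) ^ m ≤ N * 2 ^ m) (hx : 2 * x ≤ m) : ENNReal.ofReal (2 ^ x) ≤ N := by
  induction N using ENat.recTopCoe with
  | top => simp
  | coe N =>
    have hthree : (3 / 2 : ℝ) ^ m ≤ N := by
      rw [div_pow, div_le_iff₀ (by positivity)]
      exact_mod_cast h
    have hsqrt : (2 : ℝ) ^ (1 / 2 : ℝ) ≤ 3 / 2 := by
      rw [← Real.sqrt_eq_rpow, Real.sqrt_le_left (by norm_num)]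
      norm_num
    have hreal : (2 : ℝ) ^ x ≤ N :=
      calc (2 : ℝ) ^ x ≤ 2 ^ (1 / 2 * (m : ℝ)) :=
            Real.rpow_le_rpow_of_exponent_le one_le_two (by linarith)
        _ = (2 ^ (1 / 2 : ℝ)) ^ m := by rw [Real.rpow_mul zero_le_two, Real.rpow_natCast]
        _ ≤ (3 / 2) ^ m := pow_le_pow_left₀ (by positivity) hsqrt m
        _ ≤ N := hthree
    exact (ENNReal.ofReal_le_ofReal hreal).trans_eq (by simp)

end QAPExt

theorem mainTheorem3_general {n : ℕ} (hn : 16 ≤ n) {R : Set (QAPExt.QAPIndex n → ℝ)}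
    (hQAP : QAPExt.qapPolytope n ⊆ R)
    (hvalid : ∀ P, QAPExt.QAP2Admissible P P 2 → ∀ Y ∈ R, QAPExt.QAP2Inequality P P 2 Y) :
    ENNReal.ofReal ((2 : ℝ) ^ (1 / 8 * (n : ℝ))) ≤
      ((QAPExt.extensionComplexity R : ℕ∞) : ENNReal) := by
  have hexp : (n : ℝ) ≤ 4 * ((n - 7) / 2 : ℕ) := by
    exact_mod_cast (by lia : n ≤ 4 * ((n - 7) / 2))
  exact QAPExt.ofReal_two_rpow_le_of_three_pow_le
    (QAPExt.three_pow_le_extensionComplexity_of_qap2 (by lia) hQAP hvalid) (by linarith)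

theorem mainTheorem3 :
    ∃ c : ℝ, 0 < c ∧ ∃ n₀ : ℕ, ∀ n : ℕ, n₀ ≤ n →
      ∀ R : Set (QAPExt.QAPIndex n → ℝ),
        QAPExt.IsPolytope R → QAPExt.qapPolytope n ⊆ R → QAPExt.QAP2Valid R →
          ENNReal.ofReal ((2 : ℝ) ^ (c * (n : ℝ))) ≤
            ((QAPExt.extensionComplexity R : ℕ∞) : ENNReal) :=
  ⟨1 / 8, by norm_num, 16, fun _ hn _ _ hQAP hvalid =>
    mainTheorem3_general hn hQAP fun P => hvalid P P 2⟩
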